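/- Let $A$ and $B$ be two (possibly unbounded) self-adjoint operators in a complex Hilbert space $\mathcal H$. For $n\ge 1$ let $D(A^n)$ denote the natural domain of the $n$-th power, i.e. $D(A^1)=D(A)$ and $D(A^{n+1})=\{f\in D(A) : Af\in D(A^n)\}$, and put $\mathcal D^\infty(A)=\bigcap_{n\ge 1}D(A^n)$; similarly for $B$. Then $$\mathcal D^\infty(A)=\mathcal D^\infty(B)$$ if and only if the following two conditions hold: (i) for each integer $k\ge 1$ there exists an integer $\ell\ge 1$ such that $D(B^\ell)\subseteq D(A^k)$; (ii) for each integer $h\ge 1$ there exists an integer $m\ge 1$ such that $D(A^m)\subseteq D(B^h)$. -/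

import Mathlib

namespace UnboundedOperator

section Composition

variable {R : Type*} [Ring R] {E F G : Type*} [AddCommGroup E] [Module R E]
  [AddCommGroup F] [Module R F] [AddCommGroup G] [Module R G]

/-- The natural domain of the product `g f` of two partially defined operators:
all `x ∈ D(f)` with `f x ∈ D(g)`. -/
def mulDomain (g : F →ₗ.[R] G) (f : E →ₗ.[R] F) : Submodule R E :=
  (g.domain.comap f.toFun).map f.domain.subtype

theorem mem_mulDomain_iff (g : F →ₗ.[R] G) (f : E →ₗ.[R] F) (x : E) :
    x ∈ mulDomain g f ↔ ∃ h : x ∈ f.domain, f ⟨x, h⟩ ∈ g.domain := by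
  simp [mulDomain]

/-- The product (composition) `g f` of two partially defined operators on its natural domain
`{x ∈ D(f) | f x ∈ D(g)}`. -/
noncomputable def mul (g : F →ₗ.[R] G) (f : E →ₗ.[R] F) : E →ₗ.[R] G :=
  g.comp (f.domRestrict (mulDomain g f)) (by
    rintro ⟨x, hx⟩
    obtain ⟨h, hg⟩ := (mem_mulDomain_iff g f x).1 hx.1
    exact hg)

theorem mem_mul_domain_iff (g : F →ₗ.[R] G) (f : E →ₗ.[R] F) (x : E) :
    x ∈ (mul g f).domain ↔ ∃ h : x ∈ f.domain, f ⟨x, h⟩ ∈ g.domain := by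
  change x ∈ mulDomain g f ⊓ f.domain ↔ _
  rw [Submodule.mem_inf, mem_mulDomain_iff]
  exact ⟨fun h => h.1, fun h => ⟨h, h.1⟩⟩

theorem mul_apply (g : F →ₗ.[R] G) (f : E →ₗ.[R] F) (x : E) (hx : x ∈ (mul g f).domain)
    (h : x ∈ f.domain) (hg : f ⟨x, h⟩ ∈ g.domain) :
    mul g f ⟨x, hx⟩ = g ⟨f ⟨x, h⟩, hg⟩ := rfl

/-- The powers of a partially defined operator `A`: `A ^ 0` is the identity on the whole space
and `A ^ (n + 1) = A ^ n A` on its natural domain. -/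
noncomputable def pow (A : E →ₗ.[R] E) : ℕ → (E →ₗ.[R] E)
  | 0 => LinearMap.toPMap LinearMap.id ⊤
  | n + 1 => mul (pow A n) A

theorem pow_zero_domain (A : E →ₗ.[R] E) : (pow A 0).domain = ⊤ := rfl

theorem mem_pow_succ_domain_iff (A : E →ₗ.[R] E) (n : ℕ) (x : E) :
    x ∈ (pow A (n + 1)).domain ↔ ∃ h : x ∈ A.domain, A ⟨x, h⟩ ∈ (pow A n).domain :=
  mem_mul_domain_iff (pow A n) A x

/-- The space `D^∞(A) = ⋂ n ≥ 1, D(A ^ n)` of `C^∞`-vectors of `A`. -/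
noncomputable def smoothDomain (A : E →ₗ.[R] E) : Submodule R E :=
  ⨅ (n : ℕ) (_ : 1 ≤ n), (pow A n).domain

theorem mem_smoothDomain_iff (A : E →ₗ.[R] E) (x : E) :
    x ∈ smoothDomain A ↔ ∀ n : ℕ, 1 ≤ n → x ∈ (pow A n).domain := by
  simp [smoothDomain]

end Composition

end UnboundedOperator

open Filter Topology

namespace UnboundedOperator

/-! With the contractions `R = (A + i)⁻¹` and `S = (B + i)⁻¹`, `D(Aᵏ)` and `D(Bⁿ)` are the ranges of
`Rᵏ` and `Sⁿ`, and first entries of compatible sequences of `S` lie in `D^∞(B)`. These sequences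
form a Fréchet space. If all first entries lie in `ran T`, `T = Rᵏ`, the functionals `x ↦ ⟪z, x 0⟫`
with `‖T† z‖ ≤ 1` are pointwise bounded, so Banach–Steinhaus bounds them through one entry `x n`.
Such entries are dense (Mittag-Leffler), so the bound holds on all of `ran Sⁿ`, and Douglas'
criterion gives `ran Sⁿ ⊆ ran T`. The converse is formal. -/

/-- The range criterion of Douglas: a vector on which `T†` dominates lies in the range of `T`. -/
theorem mem_range_of_norm_inner_le {E F : Type*} [NormedAddCommGroup E] [InnerProductSpace ℂ E]
    [CompleteSpace E] [NormedAddCommGroup F] [InnerProductSpace ℂ F] [CompleteSpace F]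
    (T : E →L[ℂ] F) (y : F) (C : ℝ)
    (h : ∀ z, ‖inner ℂ y z‖ ≤ C * ‖ContinuousLinearMap.adjoint T z‖) : ∃ u, T u = y := by
  set S := ContinuousLinearMap.adjoint T with hS
  obtain ⟨g, hg⟩ := S.toLinearMap.rangeRestrict.exists_rightInverse_of_surjective
    S.toLinearMap.range_rangeRestrict
  have hg' : ∀ w, S (g w) = w := fun w => congrArg Subtype.val (LinearMap.congr_fun hg w)
  obtain ⟨φ, hφ, -⟩ := exists_extension_norm_eq S.toLinearMap.range
    (((innerSL ℂ y).toLinearMap ∘ₗ g).mkContinuous C fun w => by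
      have := h (g w)
      rw [hg'] at this
      exact this)
  refine ⟨(InnerProductSpace.toDual ℂ E).symm φ, ext_inner_right ℂ fun z => ?_⟩
  rw [← ContinuousLinearMap.adjoint_inner_right, ← hS, InnerProductSpace.toDual_symm_apply]
  have h1 : φ (S z) = inner ℂ y (g ⟨S z, z, rfl⟩) := hφ ⟨S z, z, rfl⟩
  -- This vector lies in `ker S`, so the bound forces `y` to be orthogonal to it: the choice of
  -- preimage is immaterial.
  have h2 := h (g ⟨S z, z, rfl⟩ - z)
  rw [map_sub, hg', sub_self, norm_zero, mul_zero, norm_le_zero_iff, inner_sub_right,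
    sub_eq_zero] at h2
  rw [h1, h2]

/-! ### Projective limits and Mittag-Leffler density -/

section CompatibleSequences

variable {E : Type*} [NormedAddCommGroup E] [NormedSpace ℂ E]

/-- The projective limit of `⋯ → E → E → E` with all maps equal to `S`. -/
def compatibleSeq (S : E →L[ℂ] E) : Submodule ℂ (ℕ → E) where
  carrier := {x | ∀ n, x n = S (x (n + 1))}
  zero_mem' := by simp
  add_mem' := fun hx hy n => by simp only [Pi.add_apply, map_add]; rw [hx n, hy n]
  smul_mem' := fun c x hx n => by simp only [Pi.smul_apply, map_smul]; rw [hx n]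

theorem mem_compatibleSeq {S : E →L[ℂ] E} {x : ℕ → E} :
    x ∈ compatibleSeq S ↔ ∀ n, x n = S (x (n + 1)) := Iff.rfl

theorem isClosed_compatibleSeq (S : E →L[ℂ] E) : IsClosed (compatibleSeq S : Set (ℕ → E)) := by
  have : (compatibleSeq S : Set (ℕ → E)) = ⋂ n, {x | x n = S (x (n + 1))} := by
    ext x
    simp [mem_compatibleSeq]
  rw [this]
  exact isClosed_iInter fun n => isClosed_eq (by fun_prop) (by fun_prop)

theorem compatibleSeq_eq_pow {S : E →L[ℂ] E} {x : ℕ → E} (hx : x ∈ compatibleSeq S) (j n : ℕ) :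
    x j = (S ^ n) (x (j + n)) := by
  induction n with
  | zero => simp
  | succ n ih => rw [ih, hx (j + n), pow_succ]; rfl

theorem norm_pow_apply_le {S : E →L[ℂ] E} (hS : ∀ x, ‖S x‖ ≤ ‖x‖) (n : ℕ) (x : E) :
    ‖(S ^ n) x‖ ≤ ‖x‖ := by
  induction n with
  | zero => simp
  | succ n ih =>
    rw [pow_succ']
    exact (hS _).trans ih

/-- Mittag-Leffler: the first projection of the projective limit has dense range. -/
theorem exists_compatibleSeq_dist_lt [CompleteSpace E] {S : E →L[ℂ] E} (hS : ∀ x, ‖S x‖ ≤ ‖x‖)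
    (hd : DenseRange S) (h : E) {ε : ℝ} (hε : 0 < ε) :
    ∃ x ∈ compatibleSeq S, dist h (x 0) < ε := by
  have hstep : ∀ (n : ℕ) (a : E), ∃ b, dist a (S b) < ε / 2 / 2 / 2 ^ n := fun n a =>
    hd.exists_dist_lt a (by positivity)
  choose f hf using hstep
  let a : ℕ → E := fun n => Nat.rec h (fun n b => f n b) n
  have ha : ∀ n, dist (a n) (S (a (n + 1))) < ε / 2 / 2 / 2 ^ n := fun n => hf n (a n)
  have hdist : ∀ m n, dist ((S ^ n) (a (m + n))) ((S ^ (n + 1)) (a (m + (n + 1)))) ≤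
      ε / 2 / 2 / 2 ^ n := by
    intro m n
    rw [pow_succ, mul_apply_eq_comp, dist_eq_norm, ← map_sub, ← add_assoc]
    refine (norm_pow_apply_le hS n _).trans ?_
    rw [← dist_eq_norm]
    refine (ha (m + n)).le.trans ?_
    gcongr
    · norm_num
    · omega
  have hlim : ∀ m, ∃ x, Tendsto (fun n => (S ^ n) (a (m + n))) atTop (𝓝 x) := fun m =>
    cauchySeq_tendsto_of_complete (cauchySeq_of_le_geometric_two (hdist m))
  choose x hx using hlim
  refine ⟨x, fun m => ?_, ?_⟩
  · refine tendsto_nhds_unique ((tendsto_add_atTop_iff_nat 1).2 (hx m)) ?_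
    refine ((S.continuous.tendsto _).comp (hx (m + 1))).congr fun n => ?_
    rw [pow_succ', mul_apply_eq_comp, Function.comp_apply]
    rw [add_assoc m 1 n, add_comm 1 n]
  · have := dist_le_of_le_geometric_two_of_tendsto₀ (hdist 0) (hx 0)
    simp only [pow_zero, add_zero] at this
    change dist h (x 0) ≤ ε / 2 at this
    linarith

theorem dense_compatibleSeq_eval [CompleteSpace E] {S : E →L[ℂ] E} (hS : ∀ x, ‖S x‖ ≤ ‖x‖)
    (hd : DenseRange S) (n : ℕ) : Dense {h : E | ∃ x ∈ compatibleSeq S, x n = h} := by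
  refine Metric.dense_iff.2 fun h ε hε => ?_
  obtain ⟨x, hx, hxh⟩ := exists_compatibleSeq_dist_lt hS hd h hε
  -- Shift the sequence to start at index `n` and fill the earlier entries with powers of `S`;
  -- truncated subtraction covers both ranges.
  refine ⟨x 0, by rwa [Metric.mem_ball, dist_comm], fun m => (S ^ (n - m)) (x (m - n)), ?_, ?_⟩
  · intro m
    beta_reduce
    rcases lt_or_ge m n with h | h
    · rw [show n - m = n - (m + 1) + 1 by omega, show m - n = 0 by omega,
        show m + 1 - n = 0 by omega, pow_succ']
      rfl
    · rw [show n - m = 0 by omega, show n - (m + 1) = 0 by omega,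
        show m + 1 - n = m - n + 1 by omega]
      exact hx (m - n)
  · simp

end CompatibleSequences

/-! ### Uniform boundedness on the projective limit -/

section Range

variable {E : Type*} [NormedAddCommGroup E] [InnerProductSpace ℂ E] [CompleteSpace E]

/-- If the limit of the decreasing sequence of ranges of `S ^ n` lies in the range of `T`, then
so does the range of some `S ^ n`. -/
theorem exists_range_pow_subset_range {S T : E →L[ℂ] E} (hS : ∀ x, ‖S x‖ ≤ ‖x‖)
    (hd : DenseRange S) (h : ∀ x ∈ compatibleSeq S, ∃ u, T u = x 0) :
    ∃ n, ∀ y, ∃ u, T u = (S ^ n) y := by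
  let X := compatibleSeq S
  have : CompleteSpace X := (isClosed_compatibleSeq S).completeSpace_coe
  have : IsUniformAddGroup X := inferInstanceAs (IsUniformAddGroup X.toAddSubgroup)
  have : IsCountablyGenerated (uniformity X) :=
    inferInstanceAs (IsCountablyGenerated (uniformity (X : Set (ℕ → E))))
  let Z := {z : E // ‖ContinuousLinearMap.adjoint T z‖ ≤ 1}
  let e : X →L[ℂ] E := (ContinuousLinearMap.proj 0).comp X.subtypeL
  let 𝓕 : Z → X →L[ℂ] ℂ := fun z => (innerSL ℂ z.1).comp e
  have h𝓕 : ∀ z (x : X), 𝓕 z x = inner ℂ z.1 (x.1 0) := fun _ _ => rfl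
  have hequi : UniformEquicontinuous ((↑) ∘ 𝓕 : Z → X → ℂ) := by
    refine WithSeminorms.banach_steinhaus (norm_withSeminorms ℂ ℂ) fun _ x => ?_
    obtain ⟨u, hu⟩ := h x.1 x.2
    refine ⟨‖u‖, ?_⟩
    rintro _ ⟨z, rfl⟩
    change ‖𝓕 z x‖ ≤ ‖u‖
    rw [h𝓕, ← hu, ← ContinuousLinearMap.adjoint_inner_left]
    refine (norm_inner_le_norm _ _).trans ?_
    exact mul_le_of_le_one_left (norm_nonneg _) z.2
  have hnhds : {x : X | ∀ z, ‖𝓕 z x‖ < 1} ∈ 𝓝 (0 : X) := by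
    filter_upwards [Metric.equicontinuousAt_iff_right.1 (hequi.equicontinuous 0) 1 one_pos]
      with x hx z
    simpa using hx z
  -- A basic neighbourhood restricts finitely many entries; as `S` is a contraction, the one of
  -- largest index controls the others.
  obtain ⟨n, δ, hδ, hn⟩ : ∃ (n : ℕ) (δ : ℝ), 0 < δ ∧
      ∀ x : X, ‖x.1 n‖ < δ → ∀ z, ‖𝓕 z x‖ < 1 := by
    obtain ⟨V, hV, hVs⟩ := mem_nhds_subtype _ _ _ |>.1 hnhds
    rw [ZeroMemClass.coe_zero, nhds_pi, Filter.mem_pi] at hV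
    obtain ⟨I, hI, t, ht, hIt⟩ := hV
    obtain ⟨n, hnI⟩ := hI.bddAbove
    have hball : (⋂ i ∈ I, t i) ∈ 𝓝 (0 : E) := (Filter.biInter_mem hI).2 fun i _ => ht i
    obtain ⟨δ, hδ, hδt⟩ := Metric.mem_nhds_iff.1 hball
    refine ⟨n, δ, hδ, fun x hx => hVs (hIt fun i hi => ?_)⟩
    have hi' : i + (n - i) = n := Nat.add_sub_cancel' (hnI hi)
    have hxi : ‖x.1 i‖ < δ := by
      rw [compatibleSeq_eq_pow x.2 i (n - i), hi']
      exact (norm_pow_apply_le hS _ _).trans_lt hx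
    exact Set.mem_iInter₂.1 (hδt (by simpa using hxi)) i hi
  have hbound : ∀ z : Z, ∀ y : E, ‖y‖ < δ → ‖inner ℂ z.1 ((S ^ n) y)‖ ≤ 1 := by
    intro z y hy
    have hcl : IsClosed {y : E | ‖inner ℂ z.1 ((S ^ n) y)‖ ≤ 1} :=
      isClosed_le ((innerSL ℂ z.1).comp (S ^ n)).continuous.norm continuous_const
    refine hcl.closure_subset_iff.2 ?_ ((dense_compatibleSeq_eval hS hd n).open_subset_closure_inter
      Metric.isOpen_ball (by simpa using hy : y ∈ Metric.ball (0 : E) δ))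
    rintro _ ⟨hyδ, x, hx, rfl⟩
    have := hn ⟨x, hx⟩ (by simpa using hyδ) z
    rw [h𝓕] at this
    simp only [compatibleSeq_eq_pow hx 0 n, zero_add] at this
    exact this.le
  refine ⟨n, fun y => ?_⟩
  obtain ⟨c, hc, hcy⟩ : ∃ c : ℝ, 0 < c ∧ ‖(c : ℂ) • y‖ < δ := by
    refine ⟨δ / (‖y‖ + 1), by positivity, ?_⟩
    have hpos : 0 < δ / (‖y‖ + 1) := by positivity
    rw [norm_smul, Complex.norm_real, Real.norm_of_nonneg hpos.le, div_mul_eq_mul_div,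
      div_lt_iff₀ (by positivity)]
    nlinarith [norm_nonneg y]
  refine mem_range_of_norm_inner_le T _ c⁻¹ fun z => ?_
  have key : ∀ r : ℝ, 0 < r → ‖ContinuousLinearMap.adjoint T z‖ ≤ r →
      ‖inner ℂ ((S ^ n) y) z‖ ≤ c⁻¹ * r := by
    intro r hr hzr
    have := hbound ⟨((r⁻¹ : ℝ) : ℂ) • z, by
      rw [map_smul, norm_smul, Complex.norm_real, Real.norm_of_nonneg (by positivity),
        inv_mul_le_iff₀ hr, mul_one]
      exact hzr⟩ _ hcy
    simp only [map_smul, inner_smul_left, inner_smul_right, norm_mul, Complex.norm_real,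
      RCLike.norm_conj] at this
    rw [Real.norm_of_nonneg hc.le, Real.norm_of_nonneg (by positivity), norm_inner_symm] at this
    rw [← inv_mul_le_iff₀ (by positivity), inv_inv]
    rwa [mul_left_comm, inv_mul_le_iff₀ hr, mul_one] at this
  -- The slack `η` covers the case `T† z = 0`, where `z` cannot be normalised.
  refine le_of_forall_pos_le_add fun η hη => ?_
  have := key (‖ContinuousLinearMap.adjoint T z‖ + c * η) (by positivity)
    (le_add_of_nonneg_right (by positivity))
  rwa [mul_add, inv_mul_cancel_left₀ hc.ne'] at this

end Range

/-! ### Powers of a self-adjoint operator via its resolvent -/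

section Resolvent

variable {H : Type*} [NormedAddCommGroup H] [InnerProductSpace ℂ H] [CompleteSpace H]

theorem isFormalAdjoint_self {A : H →ₗ.[ℂ] H} (hA : IsSelfAdjoint A) : A.IsFormalAdjoint A := by
  have := LinearPMap.adjoint_isFormalAdjoint hA.dense_domain
  rwa [LinearPMap.isSelfAdjoint_def.1 hA] at this

/-- The bounded-below identity `‖A x + i x‖² = ‖A x‖² + ‖x‖²`. -/
theorem norm_add_I_smul_sq {A : H →ₗ.[ℂ] H} (hA : IsSelfAdjoint A) (x : A.domain) :
    ‖A x + Complex.I • (x : H)‖ ^ 2 = ‖A x‖ ^ 2 + ‖(x : H)‖ ^ 2 := by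
  have hre : (inner ℂ (A x) (Complex.I • (x : H))).re = 0 := by
    have h1 : (starRingEnd ℂ) (inner ℂ (A x) (x : H)) = inner ℂ (A x) (x : H) := by
      rw [inner_conj_symm, isFormalAdjoint_self hA x x]
    rw [inner_smul_right, Complex.I_mul_re, Complex.conj_eq_iff_im.1 h1, neg_zero]
  have := norm_add_sq (𝕜 := ℂ) (A x) (Complex.I • (x : H))
  rw [this, RCLike.re_eq_complex_re, hre, norm_smul, Complex.norm_I]
  ring

/-- Split `(h, 0)` along the closed graph of `A` and its orthogonal complement; a pair `(q₁, q₂)` in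
the latter satisfies `A† q₂ = -q₁`, and `A† = A`. -/
theorem exists_add_I_smul_eq {A : H →ₗ.[ℂ] H} (hA : IsSelfAdjoint A) (h : H) :
    ∃ x : A.domain, A x + Complex.I • (x : H) = h := by
  let G : Submodule ℂ (WithLp 2 (H × H)) :=
    A.graph.comap (WithLp.linearEquiv 2 ℂ (H × H)).toLinearMap
  have hG : IsClosed (G : Set (WithLp 2 (H × H))) :=
    hA.isClosed.preimage (WithLp.prod_continuous_ofLp 2 H H)
  have : CompleteSpace G := hG.completeSpace_coe
  obtain ⟨p, hp, q, hq, hpq⟩ := G.exists_add_mem_mem_orthogonal (WithLp.toLp 2 (h, 0))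
  obtain ⟨f, hf1, hf2⟩ := (LinearPMap.mem_graph_iff A).1 hp
  have hq' : ∀ x : A.domain, inner ℂ (-q.fst) (x : H) = inner ℂ q.snd (A x) := by
    intro x
    have hx : WithLp.toLp 2 ((x : H), A x) ∈ G := A.mem_graph x
    have := (Submodule.mem_orthogonal' G q).1 hq _ hx
    rw [WithLp.prod_inner_apply] at this
    rw [inner_neg_left]
    exact neg_eq_of_add_eq_zero_right this
  have hmem : ∃ hm : q.snd ∈ A.adjoint.domain, A.adjoint ⟨q.snd, hm⟩ = -q.fst :=
    ⟨LinearPMap.mem_adjoint_domain_of_exists q.snd ⟨-q.fst, hq'⟩,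
      LinearPMap.adjoint_apply_eq hA.dense_domain _ hq'⟩
  rw [LinearPMap.isSelfAdjoint_def.1 hA] at hmem
  obtain ⟨hm, happ⟩ := hmem
  have e1 : h = p.fst + q.fst := congrArg WithLp.fst hpq
  have e2 : (0 : H) = p.snd + q.snd := congrArg WithLp.snd hpq
  have f1 : (f : H) = p.fst := hf1
  have f2 : A f = p.snd := hf2
  refine ⟨-⟨q.snd, hm⟩ - Complex.I • f, ?_⟩
  rw [LinearPMap.map_sub, LinearPMap.map_neg, LinearPMap.map_smul, happ, f2]
  simp only [AddSubgroupClass.coe_sub, NegMemClass.coe_neg, SetLike.val_smul, smul_sub, smul_smul,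
    Complex.I_mul_I, f1]
  rw [e1, eq_neg_of_add_eq_zero_left e2.symm]
  module

/-- The domain of `A ^ n` is the range of `R ^ n`, where `R` is the contraction
`(A + i)⁻¹`, which has dense range. -/
theorem exists_resolvent {A : H →ₗ.[ℂ] H} (hA : IsSelfAdjoint A) :
    ∃ R : H →L[ℂ] H, (∀ x, ‖R x‖ ≤ ‖x‖) ∧ DenseRange R ∧
      ∀ (n : ℕ) (x : H), x ∈ (pow A n).domain ↔ ∃ u, (R ^ n) u = x := by
  let L : A.domain →ₗ[ℂ] H := A.toFun + Complex.I • A.domain.subtype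
  have hL : ∀ x : A.domain, L x = A x + Complex.I • (x : H) := fun _ => rfl
  have hle : ∀ x : A.domain, ‖(x : H)‖ ≤ ‖L x‖ := fun x => by
    refine le_of_sq_le_sq ?_ (norm_nonneg _)
    rw [hL, norm_add_I_smul_sq hA]
    exact le_add_of_nonneg_left (sq_nonneg _)
  have hinj : Function.Injective L := (injective_iff_map_eq_zero L).2 fun x hx => by
    have := hle x
    rw [hx, norm_zero, norm_le_zero_iff] at this
    exact Subtype.ext this
  let e := LinearEquiv.ofBijective L ⟨hinj, exists_add_I_smul_eq hA⟩
  have he : ∀ y, L (e.symm y) = y := e.apply_symm_apply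
  have hbound : ∀ y, ‖((e.symm y : A.domain) : H)‖ ≤ ‖y‖ := fun y => by
    have := hle (e.symm y)
    rwa [he] at this
  let R : H →L[ℂ] H := (A.domain.subtype ∘ₗ e.symm.toLinearMap).mkContinuous 1 fun y => by
    rw [one_mul]
    exact hbound y
  have hR : ∀ y, R y = e.symm y := fun _ => rfl
  have hRL : ∀ x : A.domain, R (L x) = x := fun x => by
    rw [hR]
    exact congrArg Subtype.val (e.symm_apply_apply x)
  have hmono : ∀ n, (pow A (n + 1)).domain ≤ (pow A n).domain := by
    intro n
    induction n with
    | zero => exact fun x _ => Submodule.mem_top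
    | succ n ih =>
      intro x hx
      obtain ⟨hx1, hx2⟩ := (mem_pow_succ_domain_iff A (n + 1) x).1 hx
      exact (mem_pow_succ_domain_iff A n x).2 ⟨hx1, ih hx2⟩
  -- Bootstrap: since `A x = L x - i x`, regularity of `L x` raises that of `x` one power at a time.
  have hstep : ∀ (n : ℕ) (x : A.domain), L x ∈ (pow A n).domain → A x ∈ (pow A n).domain := by
    intro n
    induction n with
    | zero => exact fun x _ => Submodule.mem_top
    | succ n ih =>
      intro x hx
      have hxn : (x : H) ∈ (pow A (n + 1)).domain :=
        (mem_pow_succ_domain_iff A n x).2 ⟨x.2, ih x (hmono n hx)⟩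
      have := sub_mem hx (Submodule.smul_mem _ Complex.I hxn)
      rwa [hL, add_sub_cancel_right] at this
  refine ⟨R, hbound, hA.dense_domain.mono fun x hx => ⟨L ⟨x, hx⟩, hRL ⟨x, hx⟩⟩, fun n => ?_⟩
  induction n with
  | zero => exact fun x => ⟨fun _ => ⟨x, rfl⟩, fun _ => Submodule.mem_top⟩
  | succ n ih =>
    intro x
    constructor
    · intro hx
      obtain ⟨hx1, hx2⟩ := (mem_pow_succ_domain_iff A n x).1 hx
      obtain ⟨u, hu⟩ := (ih (L ⟨x, hx1⟩)).1
        (add_mem hx2 (Submodule.smul_mem _ Complex.I (hmono n hx)))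
      refine ⟨u, ?_⟩
      rw [pow_succ', mul_apply_eq_comp, hu, hRL]
    · rintro ⟨u, rfl⟩
      rw [pow_succ', mul_apply_eq_comp, hR]
      refine (mem_pow_succ_domain_iff A n _).2 ⟨(e.symm ((R ^ n) u)).2, hstep n _ ?_⟩
      rw [he]
      exact (ih _).2 ⟨u, rfl⟩

theorem exists_pow_domain_le {A B : H →ₗ.[ℂ] H} (hA : IsSelfAdjoint A) (hB : IsSelfAdjoint B)
    (h : smoothDomain B ≤ smoothDomain A) (k : ℕ) (hk : 1 ≤ k) :
    ∃ l, 1 ≤ l ∧ (pow B l).domain ≤ (pow A k).domain := by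
  obtain ⟨R, -, -, hR⟩ := exists_resolvent hA
  obtain ⟨S, hS, hSd, hS'⟩ := exists_resolvent hB
  obtain ⟨n, hn⟩ := exists_range_pow_subset_range (T := R ^ k) hS hSd fun x hx => by
    refine (hR k _).1 ((mem_smoothDomain_iff A _).1 (h ?_) k hk)
    refine (mem_smoothDomain_iff B _).2 fun m _ => (hS' m _).2 ⟨x (0 + m), ?_⟩
    exact (compatibleSeq_eq_pow hx 0 m).symm
  -- `n` may be `0`, while the exponent must be at least `1`.
  refine ⟨n + 1, Nat.le_add_left 1 n, fun x hx => (hR k x).2 ?_⟩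
  obtain ⟨u, rfl⟩ := (hS' (n + 1) x).1 hx
  rw [pow_succ]
  exact hn (S u)

end Resolvent

theorem smoothDomain_le_of_forall_exists {R E : Type*} [Ring R] [AddCommGroup E] [Module R E]
    {A B : E →ₗ.[R] E}
    (h : ∀ k : ℕ, 1 ≤ k → ∃ l : ℕ, 1 ≤ l ∧ (pow B l).domain ≤ (pow A k).domain) :
    smoothDomain B ≤ smoothDomain A := fun x hx =>
  (mem_smoothDomain_iff A x).2 fun k hk => by
    obtain ⟨l, hl, hle⟩ := h k hk
    exact hle ((mem_smoothDomain_iff B x).1 hx l hl)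

end UnboundedOperator

theorem mainTheorem3 {H : Type*} [NormedAddCommGroup H] [InnerProductSpace ℂ H] [CompleteSpace H]
    (A B : H →ₗ.[ℂ] H) (hA : IsSelfAdjoint A) (hB : IsSelfAdjoint B) :
    UnboundedOperator.smoothDomain A = UnboundedOperator.smoothDomain B ↔
      (∀ k : ℕ, 1 ≤ k → ∃ l : ℕ, 1 ≤ l ∧
        (UnboundedOperator.pow B l).domain ≤ (UnboundedOperator.pow A k).domain) ∧
      (∀ h : ℕ, 1 ≤ h → ∃ m : ℕ, 1 ≤ m ∧
        (UnboundedOperator.pow A m).domain ≤ (UnboundedOperator.pow B h).domain) :=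
  ⟨fun h => ⟨UnboundedOperator.exists_pow_domain_le hA hB h.ge,
      UnboundedOperator.exists_pow_domain_le hB hA h.le⟩,
    fun h => le_antisymm (UnboundedOperator.smoothDomain_le_of_forall_exists h.2)
      (UnboundedOperator.smoothDomain_le_of_forall_exists h.1)⟩
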